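/- Let $k\ge 2$, let $A$ be a finite alphabet, and define the $q$-binomial coefficient $\binom{u}{v}_q\in\mathbb{N}[q]$ of finite words $u,v$ over $A$ by $\binom{u}{\varepsilon}_q=1$, $\binom{\varepsilon}{v}_q=0$ if $v\ne\varepsilon$, and $$\binom{ua}{vb}_q=q^{|vb|}\binom{u}{vb}_q+\delta_{a,b}\binom{u}{v}_q\qquad(a,b\in A).$$ For a left-infinite word $\mathbf{x}=\cdots x_2x_1x_0$ over $A$ and a finite word $z$ over $A$, let $\mathfrak{s}_{\mathbf{x},z}=\sum_{r\ge 0}c_r q^r\in\mathbb{N}[[q]]$, where $c_r$ is the coefficient of $q^r$ in $\binom{x_{N-1}\cdots x_0}{z}_q$, which is the same for all $N\ge r+|z|$. Proposition. Assume that the sequence $(x_n)_{n\ge 0}$ is $k$-automatic, that is, there is a finite deterministic automaton with output which, on reading any base-$k$ representation of $n$ (most significant digit first, leading zeros allowed), outputs $x_n$, for every $n\ge 0$. Then the sequence of coefficients of $\mathfrak{s}_{\mathbf{x},z}$ is $k$-regular: the $\mathbb{Z}$-module generated by the sequences $(c_{k^e n+i})_{n\ge 0}$ with $e\ge 0$ and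 $0\le i<k^e$ is finitely generated. Moreover, write $z=z_\ell\cdots z_1$ and, for $n\ge0$, let $$T_n=\Bigl\{(i_\ell,\ldots,i_1)\in\mathbb{N}^\ell : i_\ell>\cdots>i_1,\ x_{i_j}=z_j\ (1\le j\le \ell),\ i_\ell+\cdots+i_1=n+\tfrac{\ell(\ell-1)}{2}\Bigr\}.$$ Then $T_n$ is finite and $c_n=\#T_n$ for every $n\ge 0$, and the relation $\{(n,i_\ell,\ldots,i_1) : (i_\ell,\ldots,i_1)\in T_n\}$ is first-order definable without parameters in the structure $\langle\mathbb{N},+,V_k\rangle$, where $V_k(m)$ is the largest power of $k$ dividing $m$ for $m\ge 1$, and $V_k(0)=1$. -/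

import Mathlib

open Polynomial

namespace QParikh

section Words

variable {A : Type*} [DecidableEq A]

/-- Auxiliary recursion for the `q`-binomial of two words: both words are given from right to left,
so that the head of each list is the rightmost letter of the word. -/
noncomputable def qbinRev : List A → List A → ℕ[X]
  | _, [] => 1
  | [], _ :: _ => 0
  | a :: u, b :: v => qbinRev u (b :: v) * X ^ (v.length + 1) + if a = b then qbinRev u v else 0

/-- The `q`-binomial coefficient of two finite words (lists read from left to right);
`X` plays the role of `q`. It is characterized by the three lemmas that follow. -/
noncomputable def qbin (u v : List A) : ℕ[X] := qbinRev u.reverse v.reverse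

theorem qbin_nil_right (u : List A) : qbin u [] = 1 := by
  simp [qbin, qbinRev]

theorem qbin_nil_left (v : List A) (hv : v ≠ []) : qbin ([] : List A) v = 0 := by
  unfold qbin
  rcases h : v.reverse with _ | ⟨b, w⟩
  · simp_all
  · simp [qbinRev]

theorem qbin_concat_concat (u v : List A) (a b : A) :
    qbin (u ++ [a]) (v ++ [b]) =
      qbin u (v ++ [b]) * X ^ (v ++ [b]).length + (if a = b then 1 else 0) * qbin u v := by
  simp [qbin, qbinRev]

/-- The prefix `x_{n-1} ⋯ x_0` of length `n` of the left-infinite word `⋯ x_2 x_1 x_0`. -/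
def leftPrefix {A : Type*} (x : ℕ → A) (n : ℕ) : List A := ((List.range n).map x).reverse

/-- The formal power series `∑ c_r q^r`, where `c_r` is the common value of the coefficient of `q^r`
in the `q`-binomials of all prefixes of length at least `r + |z|` of the left-infinite word with `z`
(see `coeff_qSeries` for the independence of the prefix). -/
noncomputable def qSeries (x : ℕ → A) (z : List A) : PowerSeries ℕ :=
  PowerSeries.mk fun r => (qbin (leftPrefix x (r + z.length)) z).coeff r

theorem coeff_qbinRev_concat (u v : List A) (a : A) (r : ℕ) (h : r + v.length ≤ u.length) :
    (qbinRev (u ++ [a]) v).coeff r = (qbinRev u v).coeff r := by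
  induction u generalizing v r with
  | nil =>
    cases v with
    | nil => simp [qbinRev]
    | cons b v => simp at h
  | cons c u ih =>
    cases v with
    | nil => simp [qbinRev]
    | cons b v =>
      simp only [List.length_cons] at h
      simp only [List.cons_append, qbinRev, coeff_add, coeff_mul_X_pow']
      congr 1
      · split_ifs with h1
        · exact ih _ _ (by simp only [List.length_cons]; omega)
        · rfl
      · split_ifs
        · exact ih _ _ (by omega)
        · rfl

theorem coeff_qSeries (x : ℕ → A) (z : List A) (r N : ℕ) (h : r + z.length ≤ N) :
    PowerSeries.coeff r (qSeries x z) = (qbin (leftPrefix x N) z).coeff r := by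
  induction N, h using Nat.le_induction with
  | base => simp [qSeries]
  | succ N hN ih =>
    rw [ih]
    simp only [qbin, leftPrefix, List.reverse_reverse, List.range_succ, List.map_append,
      List.map_cons, List.map_nil]
    exact (coeff_qbinRev_concat _ _ _ _ (by simpa using hN)).symm

/-- For `z = z_0 ⋯ z_{ℓ-1}`, the tuples `i_0 > ⋯ > i_{ℓ-1}` of positions of occurrences of `z` as a
subword of `⋯ x_2 x_1 x_0` such that `n = i_0 + ⋯ + i_{ℓ-1} - ℓ(ℓ-1)/2`. -/
def occurrences {A : Type*} (x : ℕ → A) (z : List A) (n : ℕ) : Set (Fin z.length → ℕ) :=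
  {i | StrictAnti i ∧ (∀ j, x (i j) = z.get j) ∧ ∑ j, i j = n + z.length * (z.length - 1) / 2}

end Words

/-- A deterministic automaton with output: input alphabet `α`, states `σ`, output alphabet `A`. -/
structure DFAO (α σ A : Type*) where
  step : σ → α → σ
  start : σ
  out : σ → A

/-- The value of a base-`k` digit string, most significant digit first, leading zeros allowed. -/
def msdValue {k : ℕ} (w : List (Fin k)) : ℕ := Nat.ofDigits k (w.reverse.map Fin.val)

/-- `x` is `k`-automatic: some finite automaton with output, reading base-`k` digits, produces `x n`
on every string representing `n` (most significant digit first). -/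
def IsKAutomatic {A : Type*} (k : ℕ) (x : ℕ → A) : Prop :=
  ∃ (σ : Type) (_ : Finite σ) (M : DFAO (Fin k) σ A),
    ∀ w : List (Fin k), M.out (w.foldl M.step M.start) = x (msdValue w)

/-- The `k`-kernel of a sequence. -/
def kKernel {R : Type*} (k : ℕ) (s : ℕ → R) : Set (ℕ → R) :=
  {t | ∃ e i : ℕ, i < k ^ e ∧ t = fun n => s (k ^ e * n + i)}

/-- A sequence of integers is `k`-regular if the `ℤ`-module generated by its `k`-kernel is
finitely generated. -/
def IsKRegular (k : ℕ) (s : ℕ → ℤ) : Prop := (Submodule.span ℤ (kKernel k s)).FG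

/-- `V_k n` is the largest power of `k` dividing `n`, with `V_k 0 = 1`. -/
noncomputable def powVal (k n : ℕ) : ℕ := if n = 0 then 1 else k ^ multiplicity k n

/-- The function symbols of the language of `⟨ℕ, +, V_k⟩`. -/
inductive BuchiFunc : ℕ → Type
  | add : BuchiFunc 2
  | val : BuchiFunc 1

/-- The first-order language of `⟨ℕ, +, V_k⟩` (equality is a logical symbol). -/
def buchiLanguage : FirstOrder.Language := ⟨BuchiFunc, fun _ => Empty⟩

/-- The structure `⟨ℕ, +, V_k⟩`. -/
@[reducible]
noncomputable def buchiStructure (k : ℕ) : buchiLanguage.Structure ℕ where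
  funMap := fun f v =>
    match f, v with
    | BuchiFunc.add, v => v 0 + v 1
    | BuchiFunc.val, v => powVal k (v 0)
  RelMap := fun r _ => Empty.elim r

/-- First-order definability (without parameters) in `⟨ℕ, +, V_k⟩`. -/
def BuchiDefinable (k : ℕ) {ι : Type*} (S : Set (ι → ℕ)) : Prop :=
  letI := buchiStructure k
  Set.Definable (∅ : Set ℕ) buchiLanguage S

end QParikh

/-! Each unfolding of the `q`-binomial recursion decides whether position 0 of the left-infinite
word is used, then shifts the word by one. Hence `q^(ℓ(ℓ-1)/2)` times the `q`-binomial of a prefix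
with `z` is the generating function, by sum of positions, of the occurrences of `z` as a subword of
that prefix (`qbinRev_mul_X_pow`). Reading off a coefficient of a long enough prefix gives `c_n =
#T_n` (`ncard_occurrences`).

The relation `(n, i) ∈ T_n` is an intersection of order conditions, letter conditions `x (i j) =
z_j` and one linear equation. Each is recognized by a finite automaton reading base-`k` digits in
parallel, least significant first (`recognizable_occurrences`). Recognizability has two
consequences. Splitting off the last digits of `i` writes the fiber counts at `k n + r` as sums of
fiber counts of other states at `n`, so the counts of finitely many states generate a module closed
under decimation; this is regularity (`Recognizable.isKRegular_ncard`). And an accepting run can be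
encoded in the base-`k` digits of finitely many numbers, which `V_k` can access; this is
definability (`Recognizable.buchiDefinable`). -/

namespace QParikh

/-! ### Coefficients of `q`-binomials count subword occurrences -/

section Occurrences

variable {A : Type*} [DecidableEq A]

open Classical in
/-- The increasing tuples of positions below `N` at which the letters of `v` occur in `x`. -/
noncomputable def occurrencesBelow (x : ℕ → A) (v : List A) (N : ℕ) :
    Finset (Fin v.length → ℕ) :=
  (Fintype.piFinset fun _ => Finset.range N).filter
    fun i => StrictMono i ∧ ∀ j, x (i j) = v.get j

theorem mem_occurrencesBelow {x : ℕ → A} {v : List A} {N : ℕ} {i : Fin v.length → ℕ} :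
    i ∈ occurrencesBelow x v N ↔ (∀ j, i j < N) ∧ StrictMono i ∧ ∀ j, x (i j) = v.get j := by
  simp [occurrencesBelow]

theorem sum_occurrencesBelow_nil (x : ℕ → A) (N : ℕ) :
    ∑ i ∈ occurrencesBelow x [] N, (X : ℕ[X]) ^ ∑ j, i j = 1 := by
  have : occurrencesBelow x [] N = {Fin.elim0} := by
    refine Finset.eq_singleton_iff_unique_mem.2 ⟨mem_occurrencesBelow.2 ?_, ?_⟩
    · exact ⟨fun j => j.elim0, fun j => j.elim0, fun j => j.elim0⟩
    · exact fun i _ => funext fun j => j.elim0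
  rw [this, Finset.sum_singleton]
  simp

theorem strictMono_cons_zero_succ {n : ℕ} {i : Fin n → ℕ} :
    StrictMono (Fin.cons 0 (fun j => i j + 1) : Fin (n + 1) → ℕ) ↔ StrictMono i := by
  constructor
  · intro h a b hab
    simpa using h (Fin.succ_lt_succ_iff.2 hab)
  · intro h a b hab
    induction a using Fin.cases with
    | zero =>
      induction b using Fin.cases with
      | zero => exact absurd hab (lt_irrefl _)
      | succ b => simp
    | succ a =>
      induction b using Fin.cases with
      | zero => exact absurd hab (Fin.not_lt_zero _)
      | succ b => simpa using h (Fin.succ_lt_succ_iff.1 hab)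

/-- The tuples are split by whether their least entry is 0. If it is not, lowering all entries by
one costs one factor `X` per entry. If it is, `x 0` must be `b`, and only the other `v.length`
entries are lowered. -/
theorem sum_occurrencesBelow_cons (x : ℕ → A) (b : A) (v : List A) (N : ℕ) :
    ∑ i ∈ occurrencesBelow x (b :: v) (N + 1), (X : ℕ[X]) ^ ∑ j, i j =
      (∑ i ∈ occurrencesBelow (fun n => x (n + 1)) (b :: v) N, (X : ℕ[X]) ^ ∑ j, i j) *
          X ^ (v.length + 1) +
        if x 0 = b then
          (∑ i ∈ occurrencesBelow (fun n => x (n + 1)) v N, (X : ℕ[X]) ^ ∑ j, i j) * X ^ v.length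
        else 0 := by
  classical
  rw [← Finset.sum_filter_not_add_sum_filter _ (fun i => i (0 : Fin (v.length + 1)) = 0)]
  congr 1
  · rw [Finset.sum_mul]
    symm
    refine Finset.sum_bij' (fun i _ j => i j + 1) (fun i _ j => i j - 1) ?_ ?_ ?_ ?_ ?_
    · intro i hi
      rw [mem_occurrencesBelow] at hi
      rw [Finset.mem_filter, mem_occurrencesBelow]
      exact ⟨⟨fun j => by simpa using hi.1 j, fun a b hab => by simpa using hi.2.1 hab, hi.2.2⟩,
        by simp⟩
    · intro i hi
      rw [Finset.mem_filter, mem_occurrencesBelow] at hi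
      obtain ⟨⟨h1, h2, h3⟩, h0⟩ := hi
      have hpos : ∀ j, 0 < i j := fun j =>
        (Nat.pos_of_ne_zero h0).trans_le (h2.monotone (Fin.zero_le (n := v.length + 1) j))
      rw [mem_occurrencesBelow]
      refine ⟨fun j => by have := h1 j; have := hpos j; omega, fun a b hab => ?_, fun j => ?_⟩
      · have := h2 hab
        have := hpos a
        show i a - 1 < i b - 1
        omega
      · rw [Nat.sub_add_cancel (hpos j)]
        exact h3 j
    · intro i _
      simp
    · intro i hi
      rw [Finset.mem_filter, mem_occurrencesBelow] at hi
      obtain ⟨⟨h1, h2, h3⟩, h0⟩ := hi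
      funext j
      exact Nat.sub_add_cancel
        ((Nat.pos_of_ne_zero h0).trans_le (h2.monotone (Fin.zero_le (n := v.length + 1) j)))
    · intro i _
      rw [← pow_add]
      congr 1
      simp [Finset.sum_add_distrib]
  · split_ifs with hb
    · rw [Finset.sum_mul]
      symm
      refine Finset.sum_bij' (fun i _ => (Fin.cons 0 (fun j => i j + 1) : Fin (v.length + 1) → ℕ))
        (fun i _ j => i (Fin.succ (n := v.length) j) - 1) ?_ ?_ ?_ ?_ ?_
      · intro i hi
        rw [mem_occurrencesBelow] at hi
        rw [Finset.mem_filter, mem_occurrencesBelow]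
        refine ⟨⟨?_, strictMono_cons_zero_succ.2 hi.2.1, ?_⟩, rfl⟩
        · exact Fin.cases (Nat.succ_pos N) fun j => by simpa using hi.1 j
        · exact Fin.cases hb fun j => by simpa using hi.2.2 j
      · intro i hi
        rw [Finset.mem_filter, mem_occurrencesBelow] at hi
        obtain ⟨⟨h1, h2, h3⟩, h0⟩ := hi
        have hpos : ∀ j, 0 < i (Fin.succ (n := v.length) j) := fun j =>
          (Nat.zero_le _).trans_lt (h2 (Fin.succ_pos (n := v.length) j))
        rw [mem_occurrencesBelow]
        refine ⟨fun j => ?_, fun a b hab => ?_, fun j => ?_⟩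
        · have := h1 (Fin.succ (n := v.length) j)
          have := hpos j
          omega
        · have := h2 (Fin.succ_lt_succ_iff (n := v.length).2 hab)
          have := hpos a
          show i (Fin.succ (n := v.length) a) - 1 < i (Fin.succ (n := v.length) b) - 1
          omega
        · rw [Nat.sub_add_cancel (hpos j)]
          exact h3 (Fin.succ (n := v.length) j)
      · intro i _
        simp
      · intro i hi
        rw [Finset.mem_filter, mem_occurrencesBelow] at hi
        obtain ⟨⟨h1, h2, h3⟩, h0⟩ := hi
        funext j
        refine Fin.cases (n := v.length) h0.symm (fun j => ?_) j
        exact Nat.sub_add_cancel ((Nat.zero_le _).trans_lt (h2 (Fin.succ_pos (n := v.length) j)))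
      · intro i _
        rw [← pow_add]
        congr 1
        simp only [List.length_cons, Fin.sum_univ_succ, Fin.cons_zero, Fin.cons_succ]
        simp [Finset.sum_add_distrib]
    · refine Finset.sum_eq_zero fun i hi => ?_
      rw [Finset.mem_filter, mem_occurrencesBelow] at hi
      refine absurd ?_ hb
      have := hi.1.2.2 (0 : Fin (v.length + 1))
      rw [hi.2] at this
      exact this

/-- Both sides satisfy the same recursion in `N`. The matched-letter term carries no power of `X` in
`qbinRev` but `X ^ v.length` in the sum over tuples; the growth of the triangular exponent makes up
the difference. -/
theorem qbinRev_mul_X_pow (v : List A) (N : ℕ) (x : ℕ → A) :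
    qbinRev ((List.range N).map x) v * X ^ (v.length * (v.length - 1) / 2) =
      ∑ i ∈ occurrencesBelow x v N, X ^ ∑ j, i j := by
  induction N generalizing v x with
  | zero =>
    cases v with
    | nil => rw [sum_occurrencesBelow_nil, qbinRev]; simp
    | cons b v =>
      have : occurrencesBelow x (b :: v) 0 = ∅ := by
        refine Finset.eq_empty_of_forall_notMem fun i hi => ?_
        exact Nat.not_lt_zero _ ((mem_occurrencesBelow.1 hi).1 (0 : Fin (v.length + 1)))
      simp [this, qbinRev]
  | succ N ih =>
    cases v with
    | nil => rw [sum_occurrencesBelow_nil, qbinRev]; simp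
    | cons b v =>
      have hlen : (v.length + 1) * v.length / 2 = v.length * (v.length - 1) / 2 + v.length := by
        have h := Nat.triangle_succ v.length
        simpa using h
      rw [sum_occurrencesBelow_cons, ← ih, ← ih, List.range_succ_eq_map, List.map_cons,
        List.map_map]
      have hx : x ∘ Nat.succ = fun n => x (n + 1) := rfl
      rw [hx, qbinRev, add_mul]
      congr 1
      · ring
      · split_ifs
        · rw [mul_assoc, ← pow_add, List.length_cons, Nat.add_sub_cancel, hlen]
        · simp

theorem coeff_qbinRev (x : ℕ → A) (v : List A) (N n : ℕ) :
    (qbinRev ((List.range N).map x) v).coeff n =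
      {i ∈ occurrencesBelow x v N | ∑ j, i j = n + v.length * (v.length - 1) / 2}.card := by
  have h := congrArg (fun p : ℕ[X] => p.coeff (n + v.length * (v.length - 1) / 2))
    (qbinRev_mul_X_pow v N x)
  simp only [coeff_mul_X_pow, finsetSum_coeff, coeff_X_pow] at h
  rw [h, Finset.card_filter]
  exact Finset.sum_congr rfl fun i _ => if_congr eq_comm rfl rfl

theorem ncard_occurrences (x : ℕ → A) (z : List A) (n : ℕ) :
    (occurrences x z n).Finite ∧
      PowerSeries.coeff n (qSeries x z) = (occurrences x z n).ncard := by
  set M := n + z.length * (z.length - 1) / 2 with hM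
  -- Large enough for the `n`-th coefficient to have stabilized, and for `N` to bound every entry of
  -- a tuple of sum `M`.
  set N := n + z.length + M + 1 with hN
  set F : Finset (Fin z.reverse.length → ℕ) :=
    {i ∈ occurrencesBelow x z.reverse N |
      ∑ j, i j = n + z.length * (z.length - 1) / 2} with hF
  -- Reversing the indices turns increasing tuples for the reversed word into decreasing tuples for
  -- `z`.
  let e : Fin z.reverse.length ≃ Fin z.length :=
    (finCongr (List.length_reverse)).trans Fin.revPerm
  let E : (Fin z.reverse.length → ℕ) ≃ (Fin z.length → ℕ) := Equiv.arrowCongr e (Equiv.refl ℕ)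
  have he : ∀ a b, e a < e b ↔ b < a := by
    intro a b
    simp [e, Fin.rev_lt_rev]
  have hget : ∀ j, z.reverse.get j = z.get (e j) := by
    intro j
    simp only [List.get_eq_getElem, List.getElem_reverse]
    congr 1
    simp [e, Fin.val_rev]
    omega
  have himg : occurrences x z n = E '' (F : Set (Fin z.reverse.length → ℕ)) := by
    ext i
    rw [Equiv.image_eq_preimage_symm, Set.mem_preimage, hF, Finset.mem_coe, Finset.mem_filter,
      mem_occurrencesBelow]
    have hsymm : ∀ j, E.symm i j = i (e j) := fun j => rfl
    have hsum : ∑ j, E.symm i j = ∑ j, i j := Equiv.sum_comp e i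
    rw [hsum]
    simp only [hsymm, hget]
    constructor
    · rintro ⟨h1, h2, h3⟩
      refine ⟨⟨fun j => ?_, fun a b hab => ?_, fun j => h2 (e j)⟩, h3⟩
      · have : i (e j) ≤ ∑ j, i j := Finset.single_le_sum (fun _ _ => Nat.zero_le _)
          (Finset.mem_univ (e j))
        omega
      · exact h1 ((he _ _).2 hab)
    · rintro ⟨⟨_, h1, h2⟩, h3⟩
      refine ⟨fun a b hab => ?_, fun j => ?_, h3⟩
      · have := @h1 (e.symm b) (e.symm a) ((he _ _).1 (by simpa using hab))
        simpa [hsymm] using this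
      · simpa using h2 (e.symm j)
  have hlen : z.reverse.length * (z.reverse.length - 1) / 2 = z.length * (z.length - 1) / 2 := by
    rw [List.length_reverse]
  constructor
  · rw [himg]
    exact F.finite_toSet.image _
  · rw [coeff_qSeries x z n N (by omega), qbin, leftPrefix, List.reverse_reverse, coeff_qbinRev,
      himg, Set.ncard_image_of_injective _ E.injective, Set.ncard_coe_finset, hF,
      hlen]

end Occurrences

end QParikh
namespace QParikh

/-! ### Sets of tuples recognized by automata on base-`k` digits -/

section Recognizable

/-- The set of tuples `v` for which appending the digits `d` to the base-`k` representations
of the entries of `v` gives an element of `S`. -/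
def digitQuotient (k : ℕ) {ι : Type*} (S : Set (ι → ℕ)) (d : ι → Fin k) : Set (ι → ℕ) :=
  {v | (fun j => k * v j + d j) ∈ S}

theorem mem_digitQuotient {k : ℕ} {ι : Type*} {S : Set (ι → ℕ)} {d : ι → Fin k} {v : ι → ℕ} :
    v ∈ digitQuotient k S d ↔ (fun j => k * v j + d j) ∈ S := Iff.rfl

/-- A set of tuples of natural numbers is `k`-recognizable if it lies in a finite family of sets
that is closed under `digitQuotient`: the states of an automaton that reads the base-`k` digits of
all entries in parallel, least significant digit first. -/
def Recognizable (k : ℕ) {ι : Type*} (S : Set (ι → ℕ)) : Prop :=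
  ∃ K : Set (Set (ι → ℕ)), K.Finite ∧ S ∈ K ∧ ∀ T ∈ K, ∀ d, digitQuotient k T d ∈ K

variable {k : ℕ} {ι κ : Type*}

theorem Recognizable.univ : Recognizable k (Set.univ : Set (ι → ℕ)) := by
  refine ⟨{Set.univ}, Set.finite_singleton _, rfl, ?_⟩
  rintro _ rfl d
  rfl

theorem Recognizable.inter {S T : Set (ι → ℕ)} (hS : Recognizable k S) (hT : Recognizable k T) :
    Recognizable k (S ∩ T) := by
  obtain ⟨K, hK, hSK, hKd⟩ := hS
  obtain ⟨L, hL, hTL, hLd⟩ := hT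
  refine ⟨Set.image2 (· ∩ ·) K L, hK.image2 _ hL, ⟨S, hSK, T, hTL, rfl⟩, ?_⟩
  rintro _ ⟨U, hU, V, hV, rfl⟩ d
  exact ⟨_, hKd U hU d, _, hLd V hV d, rfl⟩

theorem Recognizable.iInter {α : Type*} [Finite α] {S : α → Set (ι → ℕ)}
    (hS : ∀ a, Recognizable k (S a)) : Recognizable k (⋂ a, S a) := by
  classical
  have := Fintype.ofFinite α
  have h : ∀ s : Finset α, Recognizable k (⋂ a ∈ s, S a) := by
    intro s
    induction s using Finset.induction with
    | empty => simpa using Recognizable.univ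
    | insert a s _ ih =>
      rw [Finset.set_biInter_insert]
      exact (hS a).inter ih
  simpa using h Finset.univ

theorem Recognizable.preimage_comp {S : Set (κ → ℕ)} (hS : Recognizable k S) (f : κ → ι) :
    Recognizable k {v : ι → ℕ | v ∘ f ∈ S} := by
  obtain ⟨K, hK, hSK, hKd⟩ := hS
  refine ⟨(fun T => {v : ι → ℕ | v ∘ f ∈ T}) '' K, hK.image _, ⟨S, hSK, rfl⟩, ?_⟩
  rintro _ ⟨T, hT, rfl⟩ d
  exact ⟨_, hKd T hT (d ∘ f), rfl⟩

/-- Two states suffice, strict and weak inequality. The more significant digits decide first, so the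
appended digits only determine whether a tie above them is allowed. -/
theorem recognizable_lt (i j : ι) : Recognizable k {v : ι → ℕ | v i < v j} := by
  refine ⟨{{v | v i < v j}, {v | v i ≤ v j}}, by simp, by simp, ?_⟩
  have key : ∀ a b c d : ℕ, c < k → d < k → a < b → k * a + c < k * b + d := by
    intro a b c d hc _ hab
    have : k * (a + 1) ≤ k * b := Nat.mul_le_mul_left k hab
    rw [Nat.mul_succ] at this
    omega
  have key' : ∀ a b c d : ℕ, c < k → d < k → k * a + c < k * b + d → a ≤ b :=
    fun a b c d hc hd h => not_lt.1 fun hba => lt_asymm h (key b a d c hd hc hba)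
  rintro _ (rfl | rfl) d
  · by_cases hd : d i < d j
    · right
      ext v
      refine ⟨key' _ _ _ _ (d i).2 (d j).2, fun h => ?_⟩
      exact add_lt_add_of_le_of_lt (Nat.mul_le_mul_left k h) hd
    · left
      ext v
      refine ⟨fun h => ?_, key _ _ _ _ (d i).2 (d j).2⟩
      refine lt_of_le_of_ne (key' _ _ _ _ (d i).2 (d j).2 h) fun heq => hd ?_
      have h' : k * v i + d i < k * v j + d j := h
      rw [heq] at h'
      exact Nat.lt_of_add_lt_add_left h'
  · by_cases hd : d i ≤ d j
    · right
      ext v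
      refine ⟨fun h => not_lt.1 (?_ : ¬ v j < v i), fun h => ?_⟩
      · intro hlt
        exact absurd (key _ _ _ _ (d j).2 (d i).2 hlt) (not_lt.2 h)
      · exact add_le_add (Nat.mul_le_mul_left k h) hd
    · left
      ext v
      refine ⟨fun h => ?_, fun h => (key _ _ _ _ (d i).2 (d j).2 h).le⟩
      have h' : k * v i + d i ≤ k * v j + d j := h
      refine not_le.1 (fun hle => hd ?_ : ¬ v j ≤ v i)
      have : k * v j ≤ k * v i := Nat.mul_le_mul_left k hle
      rw [Fin.le_def]
      omega

/-- The state is the right-hand side, acting as a carry: appending digits `d` replaces `c'` by `(c'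
- ∑ a j * d j) / k`, or leads to the empty set if the division is not exact. Carries never leave
`[-B, B]`, since `(B + (k - 1) * B) / k = B`. -/
theorem recognizable_linear (hk : 2 ≤ k) [Fintype ι] (a : ι → ℤ) (c : ℤ) :
    Recognizable k {v : ι → ℕ | ∑ j, a j * (v j : ℤ) = c} := by
  set B : ℤ := ∑ j, |a j| + |c| with hB
  refine ⟨insert ∅ ((fun c : ℤ => {v : ι → ℕ | ∑ j, a j * (v j : ℤ) = c}) '' Set.Icc (-B) B),
    ((Set.finite_Icc _ _).image _).insert _, Or.inr ⟨c, ?_, rfl⟩, ?_⟩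
  · have : 0 ≤ ∑ j, |a j| := Finset.sum_nonneg fun _ _ => abs_nonneg _
    exact abs_le.1 (by omega)
  rintro _ (rfl | ⟨c', hc', rfl⟩) d
  · exact Or.inl rfl
  have hsum : ∀ v : ι → ℕ, ∑ j, a j * ((k * v j + d j : ℕ) : ℤ) =
      k * ∑ j, a j * (v j : ℤ) + ∑ j, a j * ((d j : ℕ) : ℤ) := by
    intro v
    rw [Finset.mul_sum, ← Finset.sum_add_distrib]
    refine Finset.sum_congr rfl fun j _ => ?_
    push_cast
    ring
  by_cases hdvd : (k : ℤ) ∣ c' - ∑ j, a j * ((d j : ℕ) : ℤ)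
  · obtain ⟨e, he⟩ := hdvd
    refine Or.inr ⟨e, ?_, ?_⟩
    · have h1 : |∑ j, a j * ((d j : ℕ) : ℤ)| ≤ (k - 1) * B := by
        calc |∑ j, a j * ((d j : ℕ) : ℤ)| ≤ ∑ j, |a j * ((d j : ℕ) : ℤ)| :=
              Finset.abs_sum_le_sum_abs _ _
          _ ≤ ∑ j, (k - 1) * |a j| := by
              refine Finset.sum_le_sum fun j _ => ?_
              rw [abs_mul, mul_comm, Nat.abs_cast]
              refine mul_le_mul_of_nonneg_right ?_ (abs_nonneg _)
              have := (d j).2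
              omega
          _ = (k - 1) * ∑ j, |a j| := by rw [Finset.mul_sum]
          _ ≤ (k - 1) * B := by
              refine mul_le_mul_of_nonneg_left ?_ (by omega)
              have := abs_nonneg c
              omega
      have h2 : |c'| ≤ B := abs_le.2 hc'
      have h3 : (k : ℤ) * |e| ≤ k * B := by
        calc (k : ℤ) * |e| = |k * e| := by rw [abs_mul, Nat.abs_cast]
          _ = |c' - ∑ j, a j * ((d j : ℕ) : ℤ)| := by rw [he]
          _ ≤ |c'| + |∑ j, a j * ((d j : ℕ) : ℤ)| := abs_sub _ _
          _ ≤ B + (k - 1) * B := add_le_add h2 h1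
          _ = k * B := by ring
      exact abs_le.1 (le_of_mul_le_mul_left h3 (by omega))
    · ext v
      simp only [mem_digitQuotient, Set.mem_ofPred_eq, hsum]
      have hk0 : (k : ℤ) ≠ 0 := by omega
      constructor
      · intro h
        rw [h]
        linarith
      · intro h
        exact mul_left_cancel₀ hk0 (by linarith)
  · refine Or.inl ?_
    ext v
    simp only [mem_digitQuotient, Set.mem_ofPred_eq, hsum, Set.mem_empty_iff_false, iff_false]
    exact fun h => hdvd ⟨∑ j, a j * (v j : ℤ), by linarith⟩

theorem exists_msdValue_eq (hk : 2 ≤ k) (n : ℕ) : ∃ w : List (Fin k), msdValue w = n := by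
  refine ⟨((Nat.digits k n).pmap Fin.mk fun d hd => Nat.digits_lt_base hk hd).reverse, ?_⟩
  rw [msdValue, List.reverse_reverse, List.map_pmap]
  simp [Nat.ofDigits_digits]

theorem msdValue_append (u w : List (Fin k)) :
    msdValue (u ++ w) = k ^ w.length * msdValue u + msdValue w := by
  simp only [msdValue, List.reverse_append, List.map_append, Nat.ofDigits_append, List.length_map,
    List.length_reverse]
  ring

theorem msdValue_singleton (d : Fin k) : msdValue [d] = d := by
  simp [msdValue]

theorem IsKAutomatic.recognizable {A : Type*} (hk : 2 ≤ k) {x : ℕ → A} (hx : IsKAutomatic k x)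
    (a : A) : Recognizable k {v : Unit → ℕ | x (v ()) = a} := by
  obtain ⟨σ, _, M, hM⟩ := hx
  choose rep hrep using exists_msdValue_eq hk
  let y : List (Fin k) → ℕ → A := fun w n => x (k ^ w.length * n + msdValue w)
  let h : (σ → σ) → ℕ → A := fun f n => M.out (f ((rep n).foldl M.step M.start))
  -- The given automaton reads the most significant digit first. To read from the other end, the
  -- states are the sequences `y w` for suffixes `w`. Each depends only on the transformation of `σ`
  -- induced by `w`, so there are finitely many.
  have hy : ∀ w, y w = h fun s => w.foldl M.step s := by
    intro w
    funext n
    simp only [y, h]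
    rw [← List.foldl_append, hM, msdValue_append, hrep]
  refine ⟨(fun y : ℕ → A => {v : Unit → ℕ | y (v ()) = a}) '' Set.range y, ?_, ?_, ?_⟩
  · refine Set.Finite.image _ ((Set.finite_range h).subset ?_)
    rintro _ ⟨w, rfl⟩
    exact ⟨fun s => w.foldl M.step s, (hy w).symm⟩
  · exact ⟨y [], ⟨[], rfl⟩, by simp [y, msdValue]⟩
  · rintro _ ⟨_, ⟨w, rfl⟩, rfl⟩ d
    refine ⟨_, ⟨d () :: w, rfl⟩, ?_⟩
    ext v
    simp only [mem_digitQuotient, Set.mem_ofPred_eq, y]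
    have h1 : msdValue (d () :: w) = k ^ w.length * (d () : ℕ) + msdValue w := by
      rw [← List.singleton_append, msdValue_append, msdValue_singleton]
    have h2 : k ^ w.length * (k * v () + d ()) + msdValue w =
        k ^ (w.length + 1) * v () + (k ^ w.length * (d () : ℕ) + msdValue w) := by
      ring
    rw [h1, List.length_cons, h2]

end Recognizable

/-! ### Fiber counts of recognizable relations are `k`-regular -/

section Regular

variable {k : ℕ}

/-- Closure under decimation puts the whole kernel inside `M`, and submodules of a finitely
generated module over the Noetherian ring `ℤ` are finitely generated. -/
theorem isKRegular_of_mem (M : Submodule ℤ (ℕ → ℤ)) (hM : M.FG)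
    (hdec : ∀ s ∈ M, ∀ r < k, (fun n => s (k * n + r)) ∈ M) {s : ℕ → ℤ} (hs : s ∈ M) :
    IsKRegular k s := by
  have hle : Submodule.span ℤ (kKernel k s) ≤ M := by
    rw [Submodule.span_le]
    rintro _ ⟨e, i, hi, rfl⟩
    induction e generalizing i with
    | zero =>
      have : i = 0 := by simpa using hi
      simpa [this] using hs
    | succ e ih =>
      have hpos : 0 < k ^ e := by
        rcases Nat.eq_zero_or_pos (k ^ e) with h | h
        · rw [pow_succ, h, zero_mul] at hi
          exact absurd hi (Nat.not_lt_zero _)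
        · exact h
      have h := hdec _ (ih (i % k ^ e) (Nat.mod_lt _ hpos)) (i / k ^ e)
        (Nat.div_lt_of_lt_mul (by rwa [← pow_succ]))
      have heq : ∀ n, k ^ (e + 1) * n + i = k ^ e * (k * n + i / k ^ e) + i % k ^ e := by
        intro n
        conv_lhs => rw [← Nat.div_add_mod i (k ^ e)]
        ring
      simpa only [heq, SetLike.mem_coe] using h
  have := isNoetherian_of_fg_of_noetherian M hM
  exact (isNoetherian_submodule.1 this) _ hle

theorem cons_mem_digitQuotient {m : ℕ} {T : Set (Fin (m + 1) → ℕ)} {n : ℕ} {i : Fin m → ℕ}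
    {r : Fin k} {d : Fin m → Fin k} :
    (Fin.cons n i ∈ digitQuotient k T (Fin.cons r d)) ↔
      (Fin.cons (k * n + r) (fun j => k * i j + d j) : Fin (m + 1) → ℕ) ∈ T := by
  rw [mem_digitQuotient]
  have : (fun j => k * (Fin.cons n i : Fin (m + 1) → ℕ) j +
      ((Fin.cons r d : Fin (m + 1) → Fin k) j : ℕ)) =
      (Fin.cons (k * n + r) (fun j => k * i j + d j) : Fin (m + 1) → ℕ) := by
    funext j
    induction j using Fin.cases <;> simp
  rw [this]

theorem mul_add_injective {α : Type*} (hk : 0 < k) {d d' : α → Fin k} {i i' : α → ℕ}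
    (h : (fun j => k * i j + d j) = fun j => k * i' j + d' j) : d = d' ∧ i = i' := by
  have hd : d = d' := by
    funext j
    have := congrArg (· % k) (congrFun h j)
    simp only [Nat.mul_add_mod, Nat.mod_eq_of_lt (d j).2, Nat.mod_eq_of_lt (d' j).2] at this
    exact Fin.ext this
  subst hd
  refine ⟨rfl, funext fun j => ?_⟩
  exact Nat.eq_of_mul_eq_mul_left hk (Nat.add_right_cancel (congrFun h j))

theorem finite_fiber_digitQuotient {m : ℕ} (hk : 0 < k) {T : Set (Fin (m + 1) → ℕ)}
    (hT : ∀ n, {i : Fin m → ℕ | Fin.cons n i ∈ T}.Finite) (n : ℕ) (r : Fin k)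
    (d : Fin m → Fin k) :
    {i : Fin m → ℕ | Fin.cons n i ∈ digitQuotient k T (Fin.cons r d)}.Finite := by
  have h := (hT (k * n + r)).preimage
    (f := fun (i : Fin m → ℕ) j => k * i j + d j) fun i _ i' _ h => (mul_add_injective hk h).2
  exact h.subset fun i hi => cons_mem_digitQuotient.1 hi

/-- Euclidean division by `k` in every entry partitions the fiber over `k * n + r` according to the
tuple `d` of last digits. -/
theorem ncard_fiber_mul_add {m : ℕ} (hk : 0 < k) {T : Set (Fin (m + 1) → ℕ)}
    (hT : ∀ n, {i : Fin m → ℕ | Fin.cons n i ∈ T}.Finite) (n : ℕ) (r : Fin k) :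
    {i : Fin m → ℕ | Fin.cons (k * n + r) i ∈ T}.ncard =
      ∑ d : Fin m → Fin k, {i : Fin m → ℕ |
        Fin.cons n i ∈ digitQuotient k T (Fin.cons r d)}.ncard := by
  let f : (Σ d : Fin m → Fin k,
      {i : Fin m → ℕ | Fin.cons n i ∈ digitQuotient k T (Fin.cons r d)}) →
      {i : Fin m → ℕ | Fin.cons (k * n + r) i ∈ T} :=
    fun p => ⟨fun j => k * p.2.1 j + p.1 j, cons_mem_digitQuotient.1 p.2.2⟩
  have hf : Function.Bijective f := by
    constructor
    · rintro ⟨d, i, hi⟩ ⟨d', i', hi'⟩ h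
      obtain ⟨rfl, rfl⟩ := mul_add_injective hk (congrArg Subtype.val h)
      rfl
    · rintro ⟨i, hi⟩
      have heq : (fun j => k * (i j / k) + i j % k) = i :=
        funext fun j => Nat.div_add_mod (i j) k
      refine ⟨⟨fun j => ⟨i j % k, Nat.mod_lt _ hk⟩, fun j => i j / k, ?_⟩, Subtype.ext heq⟩
      refine cons_mem_digitQuotient.2 ?_
      simp only [heq]
      exact hi
  have hfin : ∀ d : Fin m → Fin k,
      Finite {i : Fin m → ℕ | Fin.cons n i ∈ digitQuotient k T (Fin.cons r d)} :=
    fun d => (finite_fiber_digitQuotient hk hT n r d).to_subtype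
  simp only [← Nat.card_coe_set_eq]
  rw [← Nat.card_congr (Equiv.ofBijective f hf), Nat.card_sigma]

theorem Recognizable.isKRegular_ncard {m : ℕ} (hk : 2 ≤ k) {S : Set (Fin (m + 1) → ℕ)}
    (hS : Recognizable k S) (hfin : ∀ n, {i : Fin m → ℕ | Fin.cons n i ∈ S}.Finite) :
    IsKRegular k (fun n => ({i : Fin m → ℕ | Fin.cons n i ∈ S}.ncard : ℤ)) := by
  obtain ⟨K, hK, hSK, hKd⟩ := hS
  let g : Set (Fin (m + 1) → ℕ) → ℕ → ℤ := fun T n => {i : Fin m → ℕ | Fin.cons n i ∈ T}.ncard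
  -- Since `ncard` of an infinite set is 0, counts are additive only on states with finite fibers;
  -- this property passes to digit quotients.
  let K' := {T ∈ K | ∀ n, {i : Fin m → ℕ | Fin.cons n i ∈ T}.Finite}
  have hK' : K'.Finite := hK.subset fun T hT => hT.1
  refine isKRegular_of_mem (Submodule.span ℤ (g '' K')) (Submodule.fg_span (hK'.image g)) ?_
    (Submodule.subset_span ⟨S, ⟨hSK, hfin⟩, rfl⟩)
  intro s hs r hr
  let D : (ℕ → ℤ) →ₗ[ℤ] (ℕ → ℤ) := LinearMap.funLeft ℤ ℤ fun n => k * n + r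
  suffices h : Submodule.span ℤ (g '' K') ≤ (Submodule.span ℤ (g '' K')).comap D from h hs
  rw [Submodule.span_le]
  rintro _ ⟨T, ⟨hTK, hT⟩, rfl⟩
  have hD : D (g T) = ∑ d : Fin m → Fin k, g (digitQuotient k T (Fin.cons ⟨r, hr⟩ d)) := by
    funext n
    have h := ncard_fiber_mul_add (by omega) hT n ⟨r, hr⟩
    simp only [D, g, LinearMap.funLeft_apply, Finset.sum_apply]
    exact_mod_cast h
  rw [SetLike.mem_coe, Submodule.mem_comap, hD]
  refine Submodule.sum_mem _ fun d _ => Submodule.subset_span ⟨_, ⟨hKd T hTK _, fun n => ?_⟩, rfl⟩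
  exact finite_fiber_digitQuotient (by omega) hT n _ d

end Regular

end QParikh
namespace QParikh

/-! ### Büchi's theorem: recognizable sets are definable in `⟨ℕ, +, V_k⟩` -/

section Definability

variable {k : ℕ} {α β : Type*}

/-- Definability in `⟨ℕ, +, V_k⟩` of a function of several variables. -/
def BuchiDefinableFun (k : ℕ) {ι : Type*} (f : (ι → ℕ) → ℕ) : Prop :=
  letI := buchiStructure k
  Set.DefinableFun buchiLanguage (∅ : Set ℕ) f

theorem BuchiDefinable.and {p q : (α → ℕ) → Prop} (hp : BuchiDefinable k {v | p v})
    (hq : BuchiDefinable k {v | q v}) : BuchiDefinable k {v | p v ∧ q v} :=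
  letI := buchiStructure k
  Set.Definable.inter hp hq

theorem BuchiDefinable.or {p q : (α → ℕ) → Prop} (hp : BuchiDefinable k {v | p v})
    (hq : BuchiDefinable k {v | q v}) : BuchiDefinable k {v | p v ∨ q v} :=
  letI := buchiStructure k
  Set.Definable.union hp hq

theorem BuchiDefinable.not {p : (α → ℕ) → Prop} (hp : BuchiDefinable k {v | p v}) :
    BuchiDefinable k {v | ¬ p v} :=
  letI := buchiStructure k
  Set.Definable.compl hp

theorem BuchiDefinable.imp {p q : (α → ℕ) → Prop} (hp : BuchiDefinable k {v | p v})
    (hq : BuchiDefinable k {v | q v}) : BuchiDefinable k {v | p v → q v} := by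
  simpa only [imp_iff_not_or] using hp.not.or hq

theorem BuchiDefinable.all {γ : Type*} [Finite γ] {p : γ → (α → ℕ) → Prop}
    (hp : ∀ c, BuchiDefinable k {v | p c v}) : BuchiDefinable k {v | ∀ c, p c v} := by
  let := buchiStructure k
  have h := Set.definable_iInter_of_finite hp
  rwa [← Set.ofPred_forall] at h

theorem buchiDefinable_const (p : Prop) : BuchiDefinable k {_v : α → ℕ | p} := by
  let := buchiStructure k
  by_cases hp : p
  · simp only [hp]
    exact Set.definable_univ
  · simp only [hp]
    exact Set.definable_empty

theorem BuchiDefinable.exists [Finite β] {p : (α → ℕ) → (β → ℕ) → Prop}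
    (hp : BuchiDefinable k {w : α ⊕ β → ℕ | p (w ∘ Sum.inl) (w ∘ Sum.inr)}) :
    BuchiDefinable k {v | ∃ u, p v u} :=
  letI := buchiStructure k
  Set.Definable.exists_of_finite hp

theorem BuchiDefinable.forall [Finite β] {p : (α → ℕ) → (β → ℕ) → Prop}
    (hp : BuchiDefinable k {w : α ⊕ β → ℕ | p (w ∘ Sum.inl) (w ∘ Sum.inr)}) :
    BuchiDefinable k {v | ∀ u, p v u} :=
  letI := buchiStructure k
  Set.Definable.forall_of_finite hp

theorem buchiDefinableFun_apply (i : α) : BuchiDefinableFun k fun v : α → ℕ => v i :=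
  letI := buchiStructure k
  Set.DefinableFun.proj buchiLanguage

theorem BuchiDefinableFun.comp [Finite α] {f : (α → ℕ) → ℕ} {g : α → (β → ℕ) → ℕ}
    (hf : BuchiDefinableFun k f) (hg : ∀ i, BuchiDefinableFun k (g i)) :
    BuchiDefinableFun k fun v => f fun i => g i v :=
  letI := buchiStructure k
  Set.DefinableFun.comp (g := fun v i => g i v) hg hf

theorem BuchiDefinableFun.comp_inl [Finite α] {f : (α → ℕ) → ℕ} (hf : BuchiDefinableFun k f) :
    BuchiDefinableFun k fun w : α ⊕ β → ℕ => f (w ∘ Sum.inl) :=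
  hf.comp fun i => buchiDefinableFun_apply (Sum.inl i)

theorem BuchiDefinableFun.add {f g : (α → ℕ) → ℕ} (hf : BuchiDefinableFun k f)
    (hg : BuchiDefinableFun k g) : BuchiDefinableFun k fun v => f v + g v := by
  let := buchiStructure k
  have h : BuchiDefinableFun k fun v : Fin 2 → ℕ => v 0 + v 1 :=
    Set.DefinableFun.fun_symbol (L := buchiLanguage) (M := ℕ) BuchiFunc.add
  exact h.comp (g := ![f, g]) (Fin.forall_fin_two.2 ⟨hf, hg⟩)

theorem BuchiDefinableFun.powVal {f : (α → ℕ) → ℕ} (hf : BuchiDefinableFun k f) :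
    BuchiDefinableFun k fun v => powVal k (f v) := by
  let := buchiStructure k
  have h : BuchiDefinableFun k fun v : Fin 1 → ℕ => QParikh.powVal k (v 0) :=
    Set.DefinableFun.fun_symbol (L := buchiLanguage) (M := ℕ) BuchiFunc.val
  exact h.comp (g := fun _ => f) fun _ => hf

theorem BuchiDefinableFun.eq {f g : (α → ℕ) → ℕ} (hf : BuchiDefinableFun k f)
    (hg : BuchiDefinableFun k g) : BuchiDefinable k {v | f v = g v} :=
  letI := buchiStructure k
  Set.DefinableFun.ofPred_eq hf hg

theorem buchiDefinableFun_zero : BuchiDefinableFun k fun _ : α → ℕ => 0 := by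
  have h : BuchiDefinable k {w : Option α → ℕ | w none + w none = w none} :=
    ((buchiDefinableFun_apply none).add (buchiDefinableFun_apply none)).eq
      (buchiDefinableFun_apply none)
  have hset : Function.tupleGraph (fun _ : α → ℕ => 0) = {w | w none + w none = w none} := by
    ext w
    simp [Function.tupleGraph, eq_comm]
  let := buchiStructure k
  show Set.Definable _ _ _
  rw [hset]
  exact h

/-- This relies on the convention `V_k(0) = 1`. -/
theorem buchiDefinableFun_one : BuchiDefinableFun k fun _ : α → ℕ => 1 :=
  (buchiDefinableFun_zero (k := k)).powVal

theorem BuchiDefinableFun.const_mul {f : (α → ℕ) → ℕ} (hf : BuchiDefinableFun k f) (d : ℕ) :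
    BuchiDefinableFun k fun v => d * f v := by
  induction d with
  | zero => simpa using buchiDefinableFun_zero
  | succ d ih => simpa only [Nat.succ_mul] using ih.add hf

theorem BuchiDefinableFun.lt [Finite α] {f g : (α → ℕ) → ℕ} (hf : BuchiDefinableFun k f)
    (hg : BuchiDefinableFun k g) : BuchiDefinable k {v | f v < g v} := by
  have h : BuchiDefinable k {v | ∃ u : Unit → ℕ, f v + (u () + 1) = g v} := by
    refine BuchiDefinable.exists ?_
    exact (hf.comp_inl.add ((buchiDefinableFun_apply (Sum.inr ())).add buchiDefinableFun_one)).eq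
      hg.comp_inl
  convert h using 1
  ext v
  constructor
  · intro h
    obtain ⟨c, hc⟩ := Nat.exists_eq_add_of_lt h
    exact ⟨fun _ => c, hc.symm⟩
  · rintro ⟨u, hu⟩
    show f v < g v
    omega

theorem powVal_pow (hk : 2 ≤ k) (t : ℕ) : powVal k (k ^ t) = k ^ t := by
  have h0 : k ^ t ≠ 0 := pow_ne_zero _ (by omega)
  have hu : ¬ IsUnit k := by rw [Nat.isUnit_iff]; omega
  rw [powVal, if_neg h0, multiplicity_pow_self (by omega) hu]

theorem exists_powVal_eq (n : ℕ) : ∃ t, powVal k n = k ^ t := by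
  unfold powVal
  split_ifs
  · exact ⟨0, rfl⟩
  · exact ⟨_, rfl⟩

theorem powVal_eq_self_iff (hk : 2 ≤ k) {p : ℕ} : powVal k p = p ↔ ∃ t, p = k ^ t := by
  constructor
  · intro h
    obtain ⟨t, ht⟩ := exists_powVal_eq (k := k) p
    exact ⟨t, h.symm.trans ht⟩
  · rintro ⟨t, rfl⟩
    exact powVal_pow hk t

theorem pow_lt_powVal_iff (hk : 2 ≤ k) {b : ℕ} (hb : b ≠ 0) (t : ℕ) :
    k ^ t < powVal k b ↔ k ^ (t + 1) ∣ b := by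
  have hfin : FiniteMultiplicity k b := Nat.finiteMultiplicity_iff.2 ⟨by omega, by omega⟩
  rw [powVal, if_neg hb, Nat.pow_lt_pow_iff_right (by omega), hfin.pow_dvd_iff_le_multiplicity,
    Nat.succ_le_iff]

/-- `p` is a power of `k`, and `d` is the digit of weight `p` in the base-`k` representation
of `u`. -/
def IsDigit (k d u p : ℕ) : Prop := powVal k p = p ∧ u / p % k = d

theorem isDigit_pow (hk : 2 ≤ k) {d u t : ℕ} : IsDigit k d u (k ^ t) ↔ u / k ^ t % k = d := by
  simp [IsDigit, powVal_pow hk]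

/-- The number `u` is cut into the part below `p`, the digit at `p`, and the part above. The last
must be a multiple of `k * p`, which `p < V_k` expresses for nonzero numbers; 0 needs its own clause
because `V_k(0) = 1`. As `d` is a fixed numeral, `d * p` is an iterated sum. -/
theorem isDigit_iff (hk : 2 ≤ k) {d u p : ℕ} (hd : d < k) :
    IsDigit k d u p ↔ powVal k p = p ∧ ∃ y : Fin 2 → ℕ, u = y 0 + d * p + y 1 ∧ y 0 < p ∧
      (y 1 = 0 ∨ p < powVal k (y 1)) := by
  refine and_congr_right fun hp => ?_
  obtain ⟨t, rfl⟩ := (powVal_eq_self_iff hk).1 hp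
  have hpos : 0 < k ^ t := pow_pos (by omega) t
  constructor
  · rintro rfl
    refine ⟨![u % k ^ t, k ^ (t + 1) * (u / k ^ t / k)], ?_, Nat.mod_lt _ hpos, ?_⟩
    · show u = u % k ^ t + u / k ^ t % k * k ^ t + k ^ (t + 1) * (u / k ^ t / k)
      conv_lhs => rw [← Nat.div_add_mod u (k ^ t), ← Nat.div_add_mod (u / k ^ t) k]
      ring
    · show k ^ (t + 1) * (u / k ^ t / k) = 0 ∨ k ^ t < powVal k (k ^ (t + 1) * (u / k ^ t / k))
      refine or_iff_not_imp_left.2 fun h => ?_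
      exact (pow_lt_powVal_iff hk h t).2 (Nat.dvd_mul_right _ _)
  · rintro ⟨y, rfl, h0, h1⟩
    have hdvd : k ^ (t + 1) ∣ y 1 := by
      by_cases h : y 1 = 0
      · simp [h]
      · exact (pow_lt_powVal_iff hk h t).1 (h1.resolve_left h)
    obtain ⟨c, hc⟩ := hdvd
    have : y 0 + d * k ^ t + y 1 = y 0 + k ^ t * (d + k * c) := by
      rw [hc]
      ring
    rw [this, Nat.add_mul_div_left _ _ hpos, Nat.div_eq_of_lt h0, zero_add, Nat.add_mul_mod_self_left,
      Nat.mod_eq_of_lt hd]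

theorem buchiDefinable_isDigit [Finite α] (hk : 2 ≤ k) {d : ℕ} (hd : d < k) {u p : (α → ℕ) → ℕ}
    (hu : BuchiDefinableFun k u) (hp : BuchiDefinableFun k p) :
    BuchiDefinable k {v | IsDigit k d (u v) (p v)} := by
  simp only [isDigit_iff hk hd]
  refine (hp.powVal.eq hp).and (BuchiDefinable.exists ?_)
  have h0 := buchiDefinableFun_apply (k := k) (Sum.inr 0 : α ⊕ Fin 2)
  have h1 := buchiDefinableFun_apply (k := k) (Sum.inr 1 : α ⊕ Fin 2)
  exact (hu.comp_inl.eq ((h0.add (hp.comp_inl.const_mul d)).add h1)).and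
    ((h0.lt hp.comp_inl).and ((h1.eq buchiDefinableFun_zero).or (hp.comp_inl.lt h1.powVal)))

theorem exists_digits_eq (hk : 0 < k) (N : ℕ) (g : ℕ → ℕ) (hg : ∀ t, g t < k) :
    ∃ w, ∀ t < N, w / k ^ t % k = g t := by
  induction N generalizing g with
  | zero => exact ⟨0, fun t ht => absurd ht (Nat.not_lt_zero t)⟩
  | succ N ih =>
    obtain ⟨w, hw⟩ := ih (fun t => g (t + 1)) fun t => hg _
    refine ⟨g 0 + k * w, fun t ht => ?_⟩
    cases t with
    | zero => simp [Nat.mod_eq_of_lt (hg 0)]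
    | succ t =>
      rw [pow_succ', ← Nat.div_div_eq_div_mul, Nat.add_mul_div_left _ _ hk,
        Nat.div_eq_of_lt (hg 0), zero_add]
      exact hw t (by omega)

/-- The encoding, by numbers `y (inl s)` for the states `s` and a power `y (inr ())` of `k`, of an
accepting run on the digits of `v`: the digit of weight `k ^ t` of `y (inl s)` is `1` if `s` is the
state reached after `t` steps. -/
def IsAcceptingRun (k : ℕ) {ι σ : Type*} (δ : σ → (ι → Fin k) → σ) (s₀ : σ) (acc : σ → Prop)
    (v : ι → ℕ) (y : σ ⊕ Unit → ℕ) : Prop :=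
  powVal k (y (.inr ())) = y (.inr ()) ∧ (∀ i, v i < y (.inr ())) ∧ IsDigit k 1 (y (.inl s₀)) 1 ∧
    (∀ p : Unit → ℕ, p () < y (.inr ()) → ∀ s d, IsDigit k 1 (y (.inl s)) (p ()) →
      (∀ i, IsDigit k (d i) (v i) (p ())) → IsDigit k 1 (y (.inl (δ s d))) (k * p ())) ∧
    ∀ s, IsDigit k 1 (y (.inl s)) (y (.inr ())) → acc s

theorem buchiDefinable_exists_isAcceptingRun (hk : 2 ≤ k) {ι σ : Type*} [Finite ι] [Finite σ]
    (δ : σ → (ι → Fin k) → σ) (s₀ : σ) (acc : σ → Prop) :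
    BuchiDefinable k {v | ∃ y, IsAcceptingRun k δ s₀ acc v y} := by
  refine BuchiDefinable.exists ?_
  have hv (i : ι) := buchiDefinableFun_apply (k := k) (Sum.inl i : ι ⊕ (σ ⊕ Unit))
  have hw (s : σ) := buchiDefinableFun_apply (k := k) (Sum.inr (.inl s) : ι ⊕ (σ ⊕ Unit))
  have hP := buchiDefinableFun_apply (k := k) (Sum.inr (.inr ()) : ι ⊕ (σ ⊕ Unit))
  refine (hP.powVal.eq hP).and ((BuchiDefinable.all fun i => (hv i).lt hP).and
    ((buchiDefinable_isDigit hk hk (hw s₀) buchiDefinableFun_one).and (.and ?_ ?_)))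
  · refine BuchiDefinable.forall ?_
    have hp := buchiDefinableFun_apply (k := k) (Sum.inr () : (ι ⊕ (σ ⊕ Unit)) ⊕ Unit)
    refine (hp.lt hP.comp_inl).imp (.all fun s => .all fun d => ?_)
    exact (buchiDefinable_isDigit hk hk (hw s).comp_inl hp).imp
      ((BuchiDefinable.all fun i => buchiDefinable_isDigit hk (d i).2 (hv i).comp_inl hp).imp
        (buchiDefinable_isDigit hk hk (hw (δ s d)).comp_inl (hp.const_mul k)))
  · exact BuchiDefinable.all fun s =>
      (buchiDefinable_isDigit hk hk (hw s) hP).imp (buchiDefinable_const (acc s))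

/-- One direction of Büchi's theorem: sets recognized by automata are definable. -/
theorem Recognizable.buchiDefinable (hk : 2 ≤ k) {ι : Type*} [Finite ι] {S : Set (ι → ℕ)}
    (hS : Recognizable k S) : BuchiDefinable k S := by
  obtain ⟨K, hK, hSK, hKd⟩ := hS
  have : DecidableEq K := Classical.decEq K
  have := Fintype.ofFinite ι
  have : Finite K := hK.to_subtype
  let δ : K → (ι → Fin k) → K := fun T d => ⟨digitQuotient k T d, hKd T T.2 d⟩
  let dig : (ι → ℕ) → ℕ → ι → Fin k := fun v t i => ⟨v i / k ^ t % k, Nat.mod_lt _ (by omega)⟩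
  let q : (ι → ℕ) → ℕ → K := fun v t => t.rec (motive := fun _ => K) ⟨S, hSK⟩ fun t s => δ s (dig v t)
  -- Invariant of the run: the state after `t` digits contains the unread part of the input exactly
  -- when `S` contains `v`. Once all digits are read, acceptance means containing the zero tuple.
  have hq : ∀ v t, v ∈ S ↔ (fun i => v i / k ^ t) ∈ (q v t).1 := by
    intro v t
    induction t with
    | zero => simp [q]
    | succ t ih =>
      rw [ih]
      show _ ↔ (fun i => k * (v i / k ^ (t + 1)) + v i / k ^ t % k) ∈ (q v t).1
      simp only [pow_succ, ← Nat.div_div_eq_div_mul, Nat.div_add_mod]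
  have hend : ∀ v N, (∀ i, v i < k ^ N) → (v ∈ S ↔ (fun _ => 0) ∈ (q v N).1) := by
    intro v N hv
    rw [hq v N]
    simp only [Nat.div_eq_of_lt (hv _)]
  convert buchiDefinable_exists_isAcceptingRun hk δ ⟨S, hSK⟩ (fun T => (fun _ => 0) ∈ T.1) using 1
  ext v
  constructor
  · intro hv
    obtain ⟨N, hN⟩ : ∃ N, ∀ i, v i < k ^ N :=
      ⟨∑ i, v i, fun i => (Finset.single_le_sum (fun _ _ => Nat.zero_le _)
        (Finset.mem_univ i)).trans_lt (Nat.lt_pow_self (by omega))⟩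
    -- There are `N + 1` digits to prescribe, since reading `N` digits visits the states at times
    -- `0, …, N`.
    have hdig : ∀ T : K, ∃ w, ∀ t < N + 1, w / k ^ t % k = if q v t = T then 1 else 0 := by
      intro T
      refine exists_digits_eq (by omega) (N + 1) _ fun t => ?_
      split_ifs <;> omega
    choose w hw using hdig
    have hw' : ∀ T, ∀ t < N + 1, (IsDigit k 1 (w T) (k ^ t) ↔ q v t = T) := by
      intro T t ht
      rw [isDigit_pow hk, hw T t ht]
      split_ifs with h <;> simp [h]
    refine ⟨Sum.elim w fun _ => k ^ N, powVal_pow hk N, hN, ?_, ?_, ?_⟩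
    · have := (hw' ⟨S, hSK⟩ 0 (by omega)).2 rfl
      rwa [pow_zero] at this
    · intro p hp T d hT hd
      simp only [Sum.elim_inl, Sum.elim_inr] at hp hT ⊢
      obtain ⟨t, ht⟩ := (powVal_eq_self_iff hk).1 hT.1
      rw [ht] at hp hT hd ⊢
      have htN : t < N := (Nat.pow_lt_pow_iff_right (by omega)).1 hp
      rw [hw' T t (by omega)] at hT
      rw [← pow_succ', hw' _ _ (by omega)]
      have hd' : dig v t = d := funext fun i => Fin.ext ((isDigit_pow hk).1 (hd i))
      rw [← hT, ← hd']
    · intro T hT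
      rw [Sum.elim_inl, Sum.elim_inr, hw' T N (by omega)] at hT
      rw [← hT]
      exact (hend v N hN).1 hv
  · rintro ⟨y, hP, hlt, h0, hstep, hacc⟩
    obtain ⟨N, hN⟩ := (powVal_eq_self_iff hk).1 hP
    rw [hN] at hlt hstep hacc
    -- The numbers `y` may mark further states besides the true run. This is harmless: the true run
    -- is always marked, and every state marked at time `N` is required to accept.
    have hrun : ∀ t ≤ N, IsDigit k 1 (y (.inl (q v t))) (k ^ t) := by
      intro t
      induction t with
      | zero => exact fun _ => by rw [pow_zero]; exact h0
      | succ t ih =>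
        intro ht
        rw [pow_succ']
        exact hstep (fun _ => k ^ t) (Nat.pow_lt_pow_right (by omega) (by omega)) _ (dig v t)
          (ih (by omega)) fun i => (isDigit_pow hk).2 rfl
    exact (hend v N hlt).2 (hacc _ (hrun N le_rfl))

end Definability

end QParikh
-- The occurrence relation is recognizable; conclusion
namespace QParikh

theorem recognizable_occurrences {A : Type*} {k : ℕ} (hk : 2 ≤ k) {x : ℕ → A}
    (hx : IsKAutomatic k x) (z : List A) :
    Recognizable k {v : Fin (z.length + 1) → ℕ | Fin.tail v ∈ occurrences x z (v 0)} := by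
  have h1 : Recognizable k (⋂ p : {p : Fin z.length × Fin z.length // p.1 < p.2},
      {v : Fin (z.length + 1) → ℕ | v p.1.2.succ < v p.1.1.succ}) :=
    Recognizable.iInter fun p => recognizable_lt _ _
  have h2 : Recognizable k (⋂ j : Fin z.length,
      {v : Fin (z.length + 1) → ℕ | v ∘ (fun _ => j.succ) ∈ {v : Unit → ℕ | x (v ()) = z.get j}}) :=
    Recognizable.iInter fun j => (hx.recognizable hk _).preimage_comp _
  -- Coordinate 0 is `n`, moved to the left-hand side with coefficient `-1`; the positions have
  -- coefficient 1.
  have h3 := recognizable_linear hk (Fin.cons (-1) fun _ => 1 : Fin (z.length + 1) → ℤ)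
    (z.length * (z.length - 1) / 2 : ℕ)
  convert h1.inter (h2.inter h3) using 1
  ext v
  simp only [occurrences, StrictAnti, Set.mem_ofPred_eq, Set.mem_inter_iff, Set.mem_iInter,
    Fin.sum_univ_succ, Fin.cons_zero, Fin.cons_succ, Fin.tail, Function.comp_apply]
  refine and_congr ⟨fun h p => h p.2, fun h a b hab => h ⟨(a, b), hab⟩⟩ (and_congr_right fun _ => ?_)
  simp only [one_mul, neg_mul]
  rw [← Nat.cast_inj (R := ℤ), Nat.cast_add, Nat.cast_sum]
  constructor <;> intro h <;> linarith

end QParikh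

theorem mainTheorem6 {A : Type*} [Finite A] [DecidableEq A] (k : ℕ) (hk : 2 ≤ k)
    (x : ℕ → A) (hx : QParikh.IsKAutomatic k x) (z : List A) :
    QParikh.IsKRegular k (fun n => ((PowerSeries.coeff n (QParikh.qSeries x z) : ℕ) : ℤ)) ∧
    (∀ n, (QParikh.occurrences x z n).Finite ∧
      PowerSeries.coeff n (QParikh.qSeries x z) = (QParikh.occurrences x z n).ncard) ∧
    QParikh.BuchiDefinable k
      {v : Fin (z.length + 1) → ℕ | Fin.tail v ∈ QParikh.occurrences x z (v 0)} := by
  have hrec := QParikh.recognizable_occurrences hk hx z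
  refine ⟨?_, QParikh.ncard_occurrences x z, hrec.buchiDefinable hk⟩
  have hfib : ∀ n, {i : Fin z.length → ℕ | Fin.cons n i ∈
      {v : Fin (z.length + 1) → ℕ | Fin.tail v ∈ QParikh.occurrences x z (v 0)}} =
      QParikh.occurrences x z n := fun n => rfl
  have h := hrec.isKRegular_ncard hk fun n => by
    rw [hfib]
    exact (QParikh.ncard_occurrences x z n).1
  simp only [hfib] at h
  simpa only [(QParikh.ncard_occurrences x z _).2] using h
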